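/- Let $\{f_\theta:\theta\in\Theta\}$, $\Theta\subset\mathbb R^p$, be a family of probability densities with respect to a measure $\mu$ on a measurable space $\mathcal X$, let $\beta\ge 0$, and let $\theta_0$ be an interior point of $\Theta$ such that $\theta\mapsto f_\theta(x)$ is differentiable at $\theta_0$ for $\mu$-almost every $x$ with $f_{\theta_0}(x)>0$. Write $s_{\theta}(x)=\frac{\partial}{\partial\theta}\log f_\theta(x)$ for the score, $$\xi_\beta(\theta)=\int s_\theta f_\theta^{\beta+1}\,d\mu,\qquad K_\beta(\theta)=\int s_\theta s_\theta^{T} f_\theta^{2\beta+1}\,d\mu-\xi_\beta(\theta)\,\xi_\beta(\theta)^{T},$$ $$u_\beta(x,\theta)=s_\theta(x)f_\theta(x)^{\beta}-\int s_\theta f_\theta^{\beta+1}\,d\mu .$$ Assume that $s_{\theta_0}f_{\theta_0}^{\beta}$ has finite second moments under the distribution with density $f_{\theta_0}$, so that $K_\beta(\theta_0)$ exists, and that $K_\beta(\theta_0)$ is nonsingular. Let $X_1,X_2,\dots$ be independent random variables, each with density $f_{\theta_0}$ with respect to $\mu$; that is, the null hypothesis $H_0:\theta=\theta_0$ holds.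 Put $$U_{\beta,n}(\theta_0)=\frac1n\sum_{i=1}^n u_\beta(X_i,\theta_0),\qquad R_{\beta,n}(\theta_0)=n\,U_{\beta,n}(\theta_0)^{T}K_\beta(\theta_0)^{-1}U_{\beta,n}(\theta_0).$$ Then, as $n\to\infty$, the Rao-type test statistic $R_{\beta,n}(\theta_0)$ converges in distribution to the chi-square distribution with $p$ degrees of freedom, i.e. to the law of $Z_1^2+\dots+Z_p^2$ for independent standard normal $Z_1,\dots,Z_p$. -/

import Mathlib

open MeasureTheory ProbabilityTheory Filter
open scoped Topology Matrix

noncomputable section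

namespace RaoTest

/-- The parameter space `ℝ^p`, with its Euclidean structure. -/
abbrev Param (p : ℕ) : Type := EuclideanSpace ℝ (Fin p)

variable {p : ℕ} {𝓧 : Type*}

/-- The likelihood score `s_θ(x) = ∂/∂θ log f_θ(x)` of a family `f` of densities. -/
def score (f : Param p → 𝓧 → ℝ) (θ : Param p) (x : 𝓧) : Param p :=
  gradient (fun θ' : Param p => Real.log (f θ' x)) θ

variable [MeasurableSpace 𝓧]

/-- The distribution of one observation when the true parameter is `θ`: density `f_θ` with respect
to the dominating measure `μ`. -/
def modelMeasure (μ : Measure 𝓧) (f : Param p → 𝓧 → ℝ) (θ : Param p) : Measure 𝓧 :=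
  μ.withDensity (fun x => ENNReal.ofReal (f θ x))

/-- `ξ_β(θ) = ∫ s_θ f_θ^(β+1) dμ`. -/
def xi (μ : Measure 𝓧) (f : Param p → 𝓧 → ℝ) (β : ℝ) (θ : Param p) : Param p :=
  ∫ x, (f θ x ^ (β + 1)) • score f θ x ∂μ

/-- `K_β(θ) = ∫ s_θ s_θᵀ f_θ^(2β+1) dμ - ξ_β(θ) ξ_β(θ)ᵀ`, entry by entry. -/
def matrixK (μ : Measure 𝓧) (f : Param p → 𝓧 → ℝ) (β : ℝ) (θ : Param p) :
    Matrix (Fin p) (Fin p) ℝ :=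
  Matrix.of fun j k =>
    (∫ x, score f θ x j * score f θ x k * f θ x ^ (2 * β + 1) ∂μ)
      - xi μ f β θ j * xi μ f β θ k

/-- The β-score `u_β(x, θ) = s_θ(x) f_θ(x)^β - ∫ s_θ f_θ^(β+1) dμ`. -/
def betaScore (μ : Measure 𝓧) (f : Param p → 𝓧 → ℝ) (β : ℝ) (x : 𝓧) (θ : Param p) : Param p :=
  (f θ x ^ β) • score f θ x - ∫ y, (f θ y ^ (β + 1)) • score f θ y ∂μ

/-- `U_{β,n}(θ) = (1/n) ∑ u_β(X_i, θ)`, the sum running over the first `n` members of the sequence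
of observations `x 0, x 1, …`. -/
def betaScoreMean (μ : Measure 𝓧) (f : Param p → 𝓧 → ℝ) (β : ℝ) (n : ℕ) (x : ℕ → 𝓧)
    (θ : Param p) : Param p :=
  (1 / (n : ℝ)) • ∑ i ∈ Finset.range n, betaScore μ f β (x i) θ

/-- The Rao-type test statistic `R_{β,n}(θ) = n U_{β,n}(θ)ᵀ K_β(θ)⁻¹ U_{β,n}(θ)` of order `β`. -/
def raoStatistic (μ : Measure 𝓧) (f : Param p → 𝓧 → ℝ) (β : ℝ) (n : ℕ) (x : ℕ → 𝓧)
    (θ : Param p) : ℝ :=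
  (n : ℝ) * ((betaScoreMean μ f β n x θ).ofLp ⬝ᵥ
    ((matrixK μ f β θ)⁻¹ *ᵥ (betaScoreMean μ f β n x θ).ofLp))

/-- The chi-square distribution with `p` degrees of freedom: the law of `Z₁² + ⋯ + Z_p²` for
independent standard normal `Z₁, …, Z_p`. -/
def chiSquare (p : ℕ) : Measure ℝ :=
  (Measure.pi fun _ : Fin p => gaussianReal 0 1).map (fun z : Fin p → ℝ => ∑ i, z i ^ 2)

instance isProbabilityMeasure_chiSquare (p : ℕ) : IsProbabilityMeasure (chiSquare p) :=
  Measure.isProbabilityMeasure_map (Measurable.aemeasurable (by fun_prop))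

end RaoTest

end

open scoped RealInnerProductSpace

/-! Under `f_θ₀ dμ` the vector `g = f_θ₀^β s_θ₀` has mean `ξ_β` and covariance `K_β`, so `U_{β,n}`
is a centred i.i.d. sample mean. Write `K⁻¹ = BᵀB`; then `B K Bᵀ = 1`, and the statistic is `‖√n B
U‖²`. The vector `√n B U` is a normalized sum with identity covariance, so it tends to a standard
Gaussian, and the continuous map `‖·‖²` sends that limit to chi-square. The vector CLT follows from
the scalar one by testing each direction `t` (Cramér–Wold). -/

/-- **Multivariate central limit theorem** for random vectors whose covariance is the identity. -/
theorem tendstoInDistribution_inv_sqrt_smul_sum_sub_stdGaussian {E Ω Ω' : Type*}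
    [NormedAddCommGroup E] [InnerProductSpace ℝ E] [FiniteDimensional ℝ E]
    [MeasurableSpace E] [BorelSpace E] [MeasurableSpace Ω] [MeasurableSpace Ω']
    {P : Measure Ω} [IsProbabilityMeasure P] {P' : Measure Ω'} [IsProbabilityMeasure P']
    {X : ℕ → Ω → E} {Y : Ω' → E} (hY : HasLaw Y (stdGaussian E) P')
    (hX : MemLp (X 0) 2 P) (hvar : ∀ t : E, Var[fun ω => ⟪X 0 ω, t⟫; P] = ‖t‖ ^ 2)
    (hindep : iIndepFun X P) (hident : ∀ i, IdentDistrib (X i) (X 0) P P) :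
    TendstoInDistribution
      (fun (n : ℕ) ω => (√(n : ℝ))⁻¹ • (∑ k ∈ Finset.range n, X k ω - (n : ℝ) • P[X 0]))
      atTop Y (fun _ => P) P' where
  forall_aemeasurable n :=
    ((Finset.aemeasurable_fun_sum _ fun _ _ => (hident _).aemeasurable_fst).sub_const _).const_smul _
  aemeasurable_limit := hY.aemeasurable
  tendsto := by
    have hmeas (n : ℕ) : AEMeasurable (fun ω =>
        (√(n : ℝ))⁻¹ • (∑ k ∈ Finset.range n, X k ω - (n : ℝ) • P[X 0])) P :=
      ((Finset.aemeasurable_fun_sum _ fun _ _ =>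
        (hident _).aemeasurable_fst).sub_const _).const_smul _
    refine ProbabilityMeasure.tendsto_iff_tendsto_charFun.2 fun t => ?_
    rw! [hY.map_eq]
    have hinner : Measurable fun x : E => ⟪x, t⟫ := by fun_prop
    have hmean : P[fun ω => ⟪X 0 ω, t⟫] = ⟪P[X 0], t⟫ := by
      simp_rw [real_inner_comm t]
      exact integral_inner (hX.integrable (by norm_num)) t
    have hL : HasLaw (id : ℝ → ℝ) (gaussianReal 0 Var[fun ω => ⟪X 0 ω, t⟫; P].toNNReal)
        (gaussianReal 0 Var[fun ω => ⟪X 0 ω, t⟫; P].toNNReal) := HasLaw.id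
    have hclt := (tendstoInDistribution_inv_sqrt_mul_sum_sub
      (X := fun i ω => ⟪X i ω, t⟫) hL (hX.inner_const t)
      (hindep.comp (fun _ x => ⟪x, t⟫) fun _ => hinner) fun i => (hident i).comp hinner).tendsto
    -- The characteristic function of a vector at `t` is that of its projection `⟪·, t⟫` at `1`.
    have h1 := ProbabilityMeasure.tendsto_iff_tendsto_charFun.1 hclt 1
    simp only [ProbabilityMeasure.coe_mk, Measure.map_id, charFun_gaussianReal, hvar, hmean] at h1
    have hlim : charFun (stdGaussian E) t = Complex.exp (((1 : ℝ) : ℂ) * ((0 : ℝ) : ℂ) * Complex.I -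
        (((‖t‖ ^ 2).toNNReal : ℝ) : ℂ) * ((1 : ℝ) : ℂ) ^ 2 / 2) := by
      rw [charFun_stdGaussian, Real.coe_toNNReal _ (sq_nonneg _)]
      congr 1
      push_cast
      ring
    simp only [ProbabilityMeasure.coe_mk]
    rw [hlim]
    refine h1.congr fun n => ?_
    rw [charFun_apply, charFun_apply, integral_map (hmeas n) (by fun_prop), integral_map _
      (by fun_prop)]
    · refine integral_congr_ae (ae_of_all _ fun ω => ?_)
      simp [inner_smul_left, inner_sub_left, sum_inner]
    · exact ((Finset.aemeasurable_fun_sum _ fun i _ =>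
        hinner.comp_aemeasurable (hident i).aemeasurable_fst).sub_const _).const_mul _

namespace RaoTest

variable {p : ℕ} {𝓧 : Type*} [MeasurableSpace 𝓧]

lemma map_norm_sq_stdGaussian (p : ℕ) :
    (stdGaussian (Param p)).map (fun x => ‖x‖ ^ 2) = chiSquare p := by
  rw [← map_pi_eq_stdGaussian, Measure.map_map (by fun_prop) (by fun_prop), chiSquare]
  congr 1
  ext z
  simp [EuclideanSpace.real_norm_sq_eq]

lemma integral_modelMeasure {E : Type*} [NormedAddCommGroup E] [NormedSpace ℝ E]
    (μ : Measure 𝓧) {f : Param p → 𝓧 → ℝ} {θ : Param p} (hf : Measurable (f θ))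
    (hf0 : ∀ x, 0 ≤ f θ x) (g : 𝓧 → E) :
    ∫ x, g x ∂modelMeasure μ f θ = ∫ x, f θ x • g x ∂μ := by
  rw [modelMeasure, integral_withDensity_eq_integral_toReal_smul (by fun_prop) (by simp)]
  simp [ENNReal.toReal_ofReal (hf0 _)]

lemma xi_eq_integral_modelMeasure (μ : Measure 𝓧) {f : Param p → 𝓧 → ℝ} {θ : Param p}
    (hf : Measurable (f θ)) (hf0 : ∀ x, 0 ≤ f θ x) {β : ℝ} (hβ : 0 ≤ β) :
    xi μ f β θ = ∫ x, (f θ x ^ β) • score f θ x ∂modelMeasure μ f θ := by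
  rw [integral_modelMeasure μ hf hf0, xi]
  refine integral_congr_ae (ae_of_all _ fun x => ?_)
  simp only [smul_smul]
  -- Valid even where the density vanishes, because `β + 1 ≠ 0`.
  rw [Real.rpow_add_one' (hf0 x) (by positivity), mul_comm]

lemma integral_param_apply {Q : Measure 𝓧} {g : 𝓧 → Param p} (hg : Integrable g Q) (j : Fin p) :
    (∫ x, g x ∂Q) j = ∫ x, g x j ∂Q :=
  ((EuclideanSpace.proj j : Param p →L[ℝ] ℝ).integral_comp_comm hg).symm

lemma memLp_param_apply {Q : Measure 𝓧} {g : 𝓧 → Param p} (hg : MemLp g 2 Q) (j : Fin p) :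
    MemLp (fun x => g x j) 2 Q :=
  (EuclideanSpace.proj j : Param p →L[ℝ] ℝ).comp_memLp' hg

/-- `K_β(θ)` is the covariance matrix of `s_θ f_θ^β` under the model. -/
lemma matrixK_apply_eq_covariance (μ : Measure 𝓧) {f : Param p → 𝓧 → ℝ} {θ : Param p}
    (hf : Measurable (f θ)) (hf0 : ∀ x, 0 ≤ f θ x) {β : ℝ} (hβ : 0 ≤ β)
    [IsProbabilityMeasure (modelMeasure μ f θ)]
    (h : MemLp (fun x => (f θ x ^ β) • score f θ x) 2 (modelMeasure μ f θ)) (j k : Fin p) :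
    matrixK μ f β θ j k =
      cov[fun x => ((f θ x ^ β) • score f θ x) j, fun x => ((f θ x ^ β) • score f θ x) k;
        modelMeasure μ f θ] := by
  rw [covariance_eq_sub (memLp_param_apply h j) (memLp_param_apply h k),
    ← integral_param_apply (h.integrable (by norm_num)),
    ← integral_param_apply (h.integrable (by norm_num)),
    ← xi_eq_integral_modelMeasure μ hf hf0 hβ, integral_modelMeasure μ hf hf0, matrixK,
    Matrix.of_apply]
  congr 1
  refine integral_congr_ae (ae_of_all _ fun x => ?_)
  have hpow : f θ x ^ (2 * β + 1) = f θ x ^ β * f θ x ^ β * f θ x := by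
    rw [Real.rpow_add_one' (hf0 x) (by positivity), two_mul,
      Real.rpow_add_of_nonneg (hf0 x) hβ hβ]
  simp only [hpow, PiLp.smul_apply, Pi.mul_apply, smul_eq_mul]
  ring

/-- The variance of a linear functional of a random vector, in terms of its covariance matrix. -/
lemma variance_dotProduct {Q : Measure 𝓧} [IsProbabilityMeasure Q] {g : 𝓧 → Param p}
    (hg : MemLp g 2 Q) {K : Matrix (Fin p) (Fin p) ℝ}
    (hK : ∀ j k, K j k = cov[fun x => g x j, fun x => g x k; Q]) (a : Fin p → ℝ) :
    Var[fun x => a ⬝ᵥ (g x).ofLp; Q] = a ⬝ᵥ (K *ᵥ a) := by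
  have hmem (j : Fin p) : MemLp (fun x => a j * g x j) 2 Q := (memLp_param_apply hg j).const_mul _
  simp only [dotProduct]
  rw [← covariance_self (memLp_finsetSum _ fun j _ => hmem j).aemeasurable, covariance_fun_sum_fun_sum hmem hmem]
  refine Finset.sum_congr rfl fun j _ => ?_
  rw [Matrix.mulVec, dotProduct, Finset.mul_sum]
  refine Finset.sum_congr rfl fun k _ => ?_
  rw [covariance_const_mul_left, covariance_const_mul_right, hK]
  ring

/-- The quadratic form `aᵀ K a` is a variance, hence nonnegative. -/
lemma posSemidef_of_eq_covariance {Q : Measure 𝓧} [IsProbabilityMeasure Q] {g : 𝓧 → Param p}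
    (hg : MemLp g 2 Q) {K : Matrix (Fin p) (Fin p) ℝ}
    (hK : ∀ j k, K j k = cov[fun x => g x j, fun x => g x k; Q]) : K.PosSemidef := by
  refine Matrix.posSemidef_iff_dotProduct_mulVec.2 ⟨?_, fun a => ?_⟩
  · ext j k
    simp [hK, covariance_comm]
  · rw [star_trivial, ← variance_dotProduct hg hK]
    exact variance_nonneg _ _

/-- A nonsingular positive semidefinite matrix can be whitened. -/
lemma exists_whitening {K : Matrix (Fin p) (Fin p) ℝ} (hK : K.PosSemidef) (hdet : IsUnit K.det) :
    ∃ B : Matrix (Fin p) (Fin p) ℝ, K⁻¹ = Bᵀ * B ∧ B * K * Bᵀ = 1 := by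
  open scoped MatrixOrder in
  obtain ⟨B, hB⟩ := CStarAlgebra.nonneg_iff_eq_star_mul_self.1 hK.inv.nonneg
  have hB' : K⁻¹ = Bᵀ * B := by
    rw [hB, Matrix.star_eq_conjTranspose, Matrix.conjTranspose_eq_transpose_of_trivial]
  refine ⟨B, hB', ?_⟩
  have h1 : Bᵀ * (B * K) = 1 := by
    rw [← Matrix.mul_assoc, ← hB', Matrix.nonsing_inv_mul K hdet]
  -- A one-sided inverse of a square matrix is two-sided, so `Bᵀ` moves to the right.
  exact mul_eq_one_comm.1 h1

lemma dotProduct_transpose_mul_mulVec (B : Matrix (Fin p) (Fin p) ℝ) (v : Param p) :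
    v.ofLp ⬝ᵥ ((Bᵀ * B) *ᵥ v.ofLp) = ‖Matrix.toEuclideanCLM (𝕜 := ℝ) B v‖ ^ 2 := by
  rw [← Matrix.mulVec_mulVec, Matrix.dotProduct_mulVec, Matrix.vecMul_transpose,
    EuclideanSpace.real_norm_sq_eq]
  simp [dotProduct, sq, Matrix.ofLp_toEuclideanCLM]

/-- The covariance-normalized quadratic form of the centred sample mean of i.i.d. square-integrable
random vectors converges in distribution to a chi-square variable. -/
theorem tendstoInDistribution_quadraticForm_sampleMean {Q : Measure 𝓧} [IsProbabilityMeasure Q]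
    {g : 𝓧 → Param p} (hg : MemLp g 2 Q) {K : Matrix (Fin p) (Fin p) ℝ}
    (hK : ∀ j k, K j k = cov[fun x => g x j, fun x => g x k; Q]) (hdet : IsUnit K.det)
    {Ω : Type*} [MeasurableSpace Ω] {P : Measure Ω} [IsProbabilityMeasure P] {X : ℕ → Ω → 𝓧}
    (hX_indep : iIndepFun X P) (hX_law : ∀ i, HasLaw (X i) Q P) {m : ℕ → Ω → Param p}
    (hm : ∀ n ω, m n ω = (1 / (n : ℝ)) • ∑ i ∈ Finset.range n, (g (X i ω) - ∫ x, g x ∂Q)) :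
    TendstoInDistribution
      (fun (n : ℕ) ω => (n : ℝ) * ((m n ω).ofLp ⬝ᵥ (K⁻¹ *ᵥ (m n ω).ofLp))) atTop
      (id : ℝ → ℝ) (fun _ => P) (chiSquare p) := by
  obtain ⟨B, hB, hBK⟩ := exists_whitening (posSemidef_of_eq_covariance hg hK) hdet
  obtain ⟨T, hT⟩ : ∃ T : Param p →L[ℝ] Param p, T = Matrix.toEuclideanCLM (𝕜 := ℝ) B := ⟨_, rfl⟩
  have hTg : MemLp (fun x => T (g x)) 2 Q := T.comp_memLp' hg
  have hTg_law (i : ℕ) : HasLaw (fun ω => T (g (X i ω))) (Q.map fun x => T (g x)) P :=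
    HasLaw.fun_comp (Y := fun x => T (g x)) ⟨hTg.aemeasurable, rfl⟩ (hX_law i)
  have hindep : iIndepFun (fun i ω => T (g (X i ω))) P :=
    -- Square-integrability makes `g` only a.e. measurable, hence `comp₀`.
    hX_indep.comp₀ (fun _ x => T (g x)) (fun i => (hX_law i).aemeasurable) fun i => by
      rw [(hX_law i).map_eq]
      exact hTg.aemeasurable
  have hmem : MemLp (fun ω => T (g (X 0 ω))) 2 P := by
    rw [← (hX_law 0).map_eq] at hTg
    exact hTg.comp_of_map (hX_law 0).aemeasurable
  have hvar (t : Param p) : Var[fun ω => ⟪T (g (X 0 ω)), t⟫; P] = ‖t‖ ^ 2 := by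
    have hinner (x : 𝓧) : ⟪T (g x), t⟫ = (Bᵀ *ᵥ t.ofLp) ⬝ᵥ (g x).ofLp := by
      rw [Matrix.mulVec_transpose, ← Matrix.dotProduct_mulVec]
      simp [PiLp.inner_apply, dotProduct, hT, Matrix.ofLp_toEuclideanCLM]
    have h : Var[fun ω => ⟪T (g (X 0 ω)), t⟫; P] = Var[fun x => ⟪T (g x), t⟫; Q] := by
      have hmeas := (hTg.inner_const (𝕜 := ℝ) t).aemeasurable
      rw [← (hX_law 0).map_eq] at hmeas ⊢
      exact (variance_map hmeas (hX_law 0).aemeasurable).symm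
    rw [h]
    simp_rw [hinner]
    -- Whitening: the variance in direction `t` is `tᵀ B K Bᵀ t = ‖t‖²`.
    have hBt : B *ᵥ (K *ᵥ (Bᵀ *ᵥ t.ofLp)) = t.ofLp := by
      rw [Matrix.mulVec_mulVec, Matrix.mulVec_mulVec, hBK, Matrix.one_mulVec]
    rw [variance_dotProduct hg hK, Matrix.mulVec_transpose, ← Matrix.dotProduct_mulVec,
      ← Matrix.mulVec_transpose, hBt, EuclideanSpace.real_norm_sq_eq]
    simp [dotProduct, sq]
  have hmean : P[fun ω => T (g (X 0 ω))] = T (∫ x, g x ∂Q) := by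
    rw [← T.integral_comp_comm (hg.integrable (by norm_num))]
    exact (hX_law 0).integral_comp hTg.aestronglyMeasurable
  have hclt := tendstoInDistribution_inv_sqrt_smul_sum_sub_stdGaussian
    (X := fun i ω => T (g (X i ω)))
    (HasLaw.id (μ := stdGaussian (Param p))) hmem hvar hindep
    fun i => (hTg_law i).identDistrib (hTg_law 0)
  have hstat (n : ℕ) (ω : Ω) : (n : ℝ) * ((m n ω).ofLp ⬝ᵥ (K⁻¹ *ᵥ (m n ω).ofLp)) =
      ‖(√(n : ℝ))⁻¹ • (∑ k ∈ Finset.range n, T (g (X k ω)) -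
        (n : ℝ) • P[fun ω => T (g (X 0 ω))])‖ ^ 2 := by
    have hsum : T (m n ω) =
        (1 / (n : ℝ)) • (∑ k ∈ Finset.range n, T (g (X k ω)) -
          (n : ℝ) • P[fun ω => T (g (X 0 ω))]) := by
      rw [hmean, hm, map_smul, map_sum]
      simp only [map_sub, Finset.sum_sub_distrib, Finset.sum_const,
        Finset.card_range, ← Nat.cast_smul_eq_nsmul ℝ]
    rw [hB, dotProduct_transpose_mul_mulVec, ← hT, hsum,
      norm_smul, norm_smul, mul_pow, mul_pow, ← mul_assoc]
    congr 1
    -- The scalars agree: `n (1/n)² = ((√n)⁻¹)²`, both being `0` at `n = 0`.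
    rcases n.eq_zero_or_pos with rfl | hn
    · simp
    · have hn' : (0 : ℝ) < n := by exact_mod_cast hn
      simp only [Real.norm_eq_abs, sq_abs, inv_pow, Real.sq_sqrt hn'.le]
      field_simp
  have hlim := hclt.continuous_comp (g := fun x => ‖x‖ ^ 2) (by fun_prop)
  simp_rw [hstat]
  refine ⟨hlim.forall_aemeasurable, aemeasurable_id, ?_⟩
  convert! hlim.tendsto using 2
  refine congrArg (@nhds (ProbabilityMeasure ℝ) _) (Subtype.ext ?_)
  change (chiSquare p).map id = _
  rw [Measure.map_id, ← map_norm_sq_stdGaussian]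
  rfl

end RaoTest

theorem mainTheorem2 {p : ℕ} {𝓧 : Type*} [MeasurableSpace 𝓧]
    -- the parametric family of densities with respect to a dominating measure
    (μ : Measure 𝓧) (Θ : Set (RaoTest.Param p)) (f : RaoTest.Param p → 𝓧 → ℝ)
    (hf_meas : ∀ θ ∈ Θ, Measurable (f θ))
    (hf_nonneg : ∀ θ ∈ Θ, ∀ x, 0 ≤ f θ x)
    (hf_int : ∀ θ ∈ Θ, ∫ x, f θ x ∂μ = 1)
    (β : ℝ) (hβ : 0 ≤ β)
    -- the value of the parameter under the null hypothesis
    (θ₀ : RaoTest.Param p) (hθ₀ : Θ ∈ 𝓝 θ₀)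
    (hf_diff : ∀ᵐ x ∂μ, 0 < f θ₀ x → DifferentiableAt ℝ (fun θ => f θ x) θ₀)
    -- existence of the covariance matrix of the β-score, and of its inverse
    (h_moment : MemLp (fun x => (f θ₀ x ^ β) • RaoTest.score f θ₀ x) 2
      (RaoTest.modelMeasure μ f θ₀))
    (hK : IsUnit (RaoTest.matrixK μ f β θ₀).det)
    -- an i.i.d. sample from the model under the null hypothesis
    {Ω : Type*} [MeasurableSpace Ω] (P : Measure Ω) [IsProbabilityMeasure P] (X : ℕ → Ω → 𝓧)
    (hX_indep : iIndepFun X P)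
    (hX_law : ∀ i, HasLaw (X i) (RaoTest.modelMeasure μ f θ₀) P) :
    TendstoInDistribution
      (fun (n : ℕ) (ω : Ω) => RaoTest.raoStatistic μ f β n (fun i => X i ω) θ₀) atTop
      (id : ℝ → ℝ) (fun _ => P) (RaoTest.chiSquare p) := by
  have hmeas := hf_meas θ₀ (mem_of_mem_nhds hθ₀)
  have hnonneg := hf_nonneg θ₀ (mem_of_mem_nhds hθ₀)
  have hQ : IsProbabilityMeasure (RaoTest.modelMeasure μ f θ₀) :=
    (hX_law 0).isProbabilityMeasure_iff.1 inferInstance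
  refine RaoTest.tendstoInDistribution_quadraticForm_sampleMean h_moment
    (RaoTest.matrixK_apply_eq_covariance μ hmeas hnonneg hβ h_moment) hK hX_indep hX_law
    fun n ω => ?_
  -- Once the mean of `g` is written as `ξ_β`, it is by definition the centring term of `betaScore`.
  rw [← RaoTest.xi_eq_integral_modelMeasure μ hmeas hnonneg hβ]
  rfl
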